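/- Let $A\in\mathbb{Q}^{d\times d}$ and let $U,Q\subseteq\mathbb{R}^d$ be bounded convex polytopes with rational vertices. Suppose that the LTI system $(A,U)$ (with dynamics $x_{t+1}=Ax_t+u_t$, $u_t\in U$) is simple, that is: 1. $\mathbf 0$ lies in the relative interior of $U$, i.e. $\mathbf 0\in B\cap \operatorname{Span}(U)\subseteq U$ for some open ball $B$ around $\mathbf 0$; 2. the spectral radius of $A$ is less than one; 3. some positive power of $A$ has exclusively real spectrum. Write $A^*(U)=\bigcup_{m\ge 0}\sum_{i=0}^m A^i(U)$ for the set of states reachable from $\mathbf 0$ and $A^\infty(U)=\sum_{i=0}^\infty A^i(U)$. Assume moreover that all (complex) eigenvalues of $A$ are real and strictly positive, and that $A^*(U)$ is full dimensional. A separator of $A^*(U)$ and $Q$ is a nonzero vector $\tau\in\mathbb{R}^d$ such that $\langle u,\tau\rangle\le\langle v,\tau\rangle$ for all $u\in A^\infty(U)$ and all $v\in Q$. If there is a separator of $A^*(U)$ and $Q$, then there is a separator of $A^*(U)$ and $Q$ all of whose entries are algebraic numbers. -/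

import Mathlib

open scoped Matrix Topology

/-- A bounded convex polytope in `ℝ^d` with rational vertices: the convex hull of finitely many
points all of whose coordinates are rational. -/
def IsRationalPolytope {d : ℕ} (P : Set (Fin d → ℝ)) : Prop :=
  ∃ s : Finset (Fin d → ℝ),
    (∀ x ∈ s, ∀ i, ∃ q : ℚ, x i = (q : ℝ)) ∧ P = convexHull ℝ (s : Set (Fin d → ℝ))

/-- A discrete-time linear time-invariant system in dimension `d`: a rational transition matrix
and a set of controls. -/
structure LTISystem (d : ℕ) where
  /-- the transition matrix -/
  A : Matrix (Fin d) (Fin d) ℚ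
  /-- the set of controls -/
  U : Set (Fin d → ℝ)

namespace LTISystem

variable {d : ℕ} (L : LTISystem d)

/-- The transition matrix with real entries. -/
def realMatrix : Matrix (Fin d) (Fin d) ℝ := L.A.map (fun q : ℚ => (q : ℝ))

/-- The transition matrix with complex entries. Its spectrum is the set of all (complex)
eigenvalues of the transition matrix. -/
def complexMatrix : Matrix (Fin d) (Fin d) ℂ := L.A.map (fun q : ℚ => (q : ℂ))

/-- Simple LTI systems. -/
structure IsSimple : Prop where
  /-- The set of controls is a bounded convex polytope (with rational vertices). -/
  polytope : IsRationalPolytope L.U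
  /-- The origin lies in the relative interior of the set of controls. -/
  zero_mem_relInterior :
    ∃ B ∈ 𝓝 (0 : Fin d → ℝ), B ∩ (Submodule.span ℝ L.U : Set (Fin d → ℝ)) ⊆ L.U
  /-- The spectral radius is less than one. -/
  spectralRadius_lt_one : spectralRadius ℂ L.complexMatrix < 1
  /-- Some positive power of the transition matrix has exclusively real spectrum. -/
  exists_pow_real_spectrum :
    ∃ m : ℕ, 0 < m ∧ ∀ z ∈ spectrum ℂ (L.complexMatrix ^ m), z.im = 0

/-- The set `A^*(U) = ⋃ m, ∑_{i=0}^m A^i(U)` of states reachable from the origin. -/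
def reachableSet : Set (Fin d → ℝ) :=
  {x | ∃ (m : ℕ) (u : ℕ → Fin d → ℝ), (∀ i, u i ∈ L.U) ∧
    x = ∑ i ∈ Finset.range (m + 1), (L.realMatrix ^ i) *ᵥ u i}

/-- The set `A^∞(U) = ∑_{i=0}^∞ A^i(U)`. -/
def limitReachableSet : Set (Fin d → ℝ) :=
  {x | ∃ u : ℕ → Fin d → ℝ, (∀ i, u i ∈ L.U) ∧
    HasSum (fun i => (L.realMatrix ^ i) *ᵥ u i) x}

/-- The cone of separators of `A^*(U)` and `Q`. -/
def separatorCone (Q : Set (Fin d → ℝ)) : Set (Fin d → ℝ) :=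
  {τ | ∀ u ∈ L.limitReachableSet, ∀ v ∈ Q, u ⬝ᵥ τ ≤ v ⬝ᵥ τ}

/-- A separator of `A^*(U)` and `Q`: the normal vector of a hyperplane with `A^*(U)` on one side
(equivalently its closure `A^∞(U)`) and `Q` on the other. A normal vector is nonzero. -/
def IsSeparator (Q : Set (Fin d → ℝ)) (τ : Fin d → ℝ) : Prop :=
  τ ≠ 0 ∧ τ ∈ L.separatorCone Q

end LTISystem

/-! Let `K` be the field of real algebraic numbers and `τ₀` a separator. Then `τ₀` is a limit of
vectors over `K` that satisfy every `K`-linear relation of `τ₀`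
(`exists_mem_of_eventually_relationNhds`). A linear inequality over `K` true at `τ₀` persists at
such nearby vectors: a strict one by continuity, an equality because it is a relation. It remains to
reduce separation to finitely many such inequalities.

As the eigenvalues lie in `(0, 1)`, the orbit of a rational vertex is a sum of terms `n.choose k * r
^ n • w` with algebraic data. The dominant term not vanishing at `τ₀`, if any, decides comparisons
of two vertices for all `n ≥ N`, with one `N` for all nearby vectors (`IsExpPoly.exists_sign`). So
one vertex of `U` is optimal from some time on, and earlier times give finitely many comparisons.
The resulting maximiser over `A^∞(U)` is algebraic and stays optimal near `τ₀`
(`LTISystem.exists_algebraic_forall_dotProduct_le`); comparing it with the vertices of `Q` is again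
a finite task. -/

open Filter Asymptotics

/-! ### Perturbation preserving linear relations -/

/-- The neighbourhoods of `τ₀` within the set of all vectors satisfying every linear relation with
coefficients in `K` that `τ₀` satisfies. -/
def relationNhds {ι : Type*} [Fintype ι] (K : IntermediateField ℚ ℝ) (τ₀ : ι → ℝ) :
    Filter (ι → ℝ) :=
  𝓝[{τ | ∀ a : ι → ℝ, (∀ j, a j ∈ K) → a ⬝ᵥ τ₀ = 0 → a ⬝ᵥ τ = 0}] τ₀

section relationNhds

variable {ι : Type*} [Fintype ι] {K : IntermediateField ℚ ℝ} {τ₀ : ι → ℝ}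

theorem relationNhds_le_nhds : relationNhds K τ₀ ≤ 𝓝 τ₀ := nhdsWithin_le_nhds

theorem tendsto_dotProduct_relationNhds (a : ι → ℝ) :
    Tendsto (fun τ => a ⬝ᵥ τ) (relationNhds K τ₀) (𝓝 (a ⬝ᵥ τ₀)) := by
  have : Continuous fun τ : ι → ℝ => a ⬝ᵥ τ := by fun_prop
  exact this.continuousAt.tendsto.mono_left relationNhds_le_nhds

theorem eventually_dotProduct_eq_zero {a : ι → ℝ} (ha : ∀ j, a j ∈ K) (h : a ⬝ᵥ τ₀ = 0) :
    ∀ᶠ τ in relationNhds K τ₀, a ⬝ᵥ τ = 0 := by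
  filter_upwards [self_mem_nhdsWithin] with τ hτ using hτ a ha h

theorem eventually_dotProduct_nonneg {a : ι → ℝ} (ha : ∀ j, a j ∈ K) (h : 0 ≤ a ⬝ᵥ τ₀) :
    ∀ᶠ τ in relationNhds K τ₀, 0 ≤ a ⬝ᵥ τ := by
  rcases h.eq_or_lt with h | h
  · filter_upwards [eventually_dotProduct_eq_zero ha h.symm] with τ hτ using hτ.ge
  · filter_upwards [(tendsto_dotProduct_relationNhds a).eventually_const_lt h] with τ hτ using hτ.le

theorem eventually_dotProduct_le {a b : ι → ℝ} (ha : ∀ j, a j ∈ K) (hb : ∀ j, b j ∈ K)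
    (h : a ⬝ᵥ τ₀ ≤ b ⬝ᵥ τ₀) : ∀ᶠ τ in relationNhds K τ₀, a ⬝ᵥ τ ≤ b ⬝ᵥ τ := by
  have := eventually_dotProduct_nonneg (K := K) (τ₀ := τ₀) (a := b - a)
    (fun j => K.sub_mem (hb j) (ha j)) (by rw [sub_dotProduct]; linarith)
  filter_upwards [this] with τ hτ
  rw [sub_dotProduct] at hτ
  linarith

/-- Every `K`-rational neighbourhood of `τ₀` contains a point with coordinates in `K`. -/
theorem exists_mem_of_eventually_relationNhds {P : (ι → ℝ) → Prop}
    (hP : ∀ᶠ τ in relationNhds K τ₀, P τ) : ∃ τ, (∀ j, τ j ∈ K) ∧ P τ := by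
  -- Write the coordinates of `τ₀` in a `K`-basis `b` of their span and let the basis vector vary:
  -- `G x` replaces `b` by `x`. Independence of `b` makes every relation of `τ₀` hold formally,
  -- hence at every `G x`; a rational `x` close to `b` gives the point.
  let S : Submodule K ℝ := Submodule.span K (Set.range τ₀)
  have : FiniteDimensional K S := FiniteDimensional.span_of_finite K (Set.finite_range τ₀)
  let b := Module.finBasis K S
  let m (j : ι) (k) : K := b.repr ⟨τ₀ j, Submodule.subset_span ⟨j, rfl⟩⟩ k
  have hm (j : ι) : ∑ k, m j k • (b k : ℝ) = τ₀ j := by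
    have := congrArg (fun x : S => (x : ℝ))
      (b.sum_repr ⟨τ₀ j, Submodule.subset_span ⟨j, rfl⟩⟩)
    simpa only [Submodule.coe_sum, Submodule.coe_smul] using this
  let G (x : Fin (Module.finrank K S) → ℝ) (j : ι) : ℝ := ∑ k, (m j k : ℝ) * x k
  have hG : Continuous G := by fun_prop
  have hG₀ : G (fun k => (b k : ℝ)) = τ₀ := by
    funext j
    rw [← hm j]
    rfl
  have hrel (x) (a : ι → ℝ) (ha : ∀ j, a j ∈ K) (h : a ⬝ᵥ τ₀ = 0) : a ⬝ᵥ G x = 0 := by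
    let a' (j : ι) : K := ⟨a j, ha j⟩
    have hz : ∑ k, (∑ j, a' j * m j k) • b k = 0 := by
      apply Subtype.ext
      rw [ZeroMemClass.coe_zero, ← h]
      simp only [dotProduct, ← hm, Submodule.coe_sum, Submodule.coe_smul, Finset.sum_smul,
        Finset.mul_sum]
      rw [Finset.sum_comm]
      refine Finset.sum_congr rfl fun j _ => Finset.sum_congr rfl fun k _ => ?_
      simp only [mul_smul]
      rfl
    have hz' (k) : ∑ j, a j * (m j k : ℝ) = 0 := by
      have := Fintype.linearIndependent_iff.1 b.linearIndependent _ hz k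
      have := congrArg (fun x : K => (x : ℝ)) this
      simpa [a'] using this
    simp only [dotProduct, G, Finset.mul_sum]
    rw [Finset.sum_comm]
    refine Finset.sum_eq_zero fun k _ => ?_
    simp_rw [← mul_assoc]
    rw [← Finset.sum_mul, hz' k, zero_mul]
  have hlim : Tendsto G (𝓝 fun k => (b k : ℝ)) (relationNhds K τ₀) :=
    tendsto_nhdsWithin_iff.2 ⟨hG₀ ▸ hG.tendsto _, Eventually.of_forall hrel⟩
  have hd : DenseRange (fun (q : Fin (Module.finrank K S) → ℚ) k => (q k : ℝ)) :=
    DenseRange.piMap fun _ => Rat.denseRange_cast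
  obtain ⟨q, hq⟩ := hd.exists_mem_open isOpen_interior
    ⟨_, mem_interior_iff_mem_nhds.2 (hlim.eventually hP)⟩
  refine ⟨G fun k => (q k : ℝ), fun j => ?_, interior_subset (s := {x | P (G x)}) hq⟩
  exact K.sum_mem fun k _ => K.mul_mem (m j k).2 (SubfieldClass.ratCast_mem K (q k))

end relationNhds

/-! ### Exponential polynomials -/

theorem isLittleO_choose_mul_pow {p q : ℝ × ℕ} (hp : 0 < p.1) (hpq : toLex p < toLex q) :
    (fun n : ℕ => (n.choose p.2 : ℝ) * p.1 ^ n) =o[atTop]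
      fun n : ℕ => (n.choose q.2 : ℝ) * q.1 ^ n := by
  have hc (p : ℝ × ℕ) : (fun n : ℕ => (n.choose p.2 : ℝ) * p.1 ^ n) =Θ[atTop]
      fun n : ℕ => (n : ℝ) ^ p.2 * p.1 ^ n :=
    (isTheta_choose p.2).mul (isTheta_refl _ _)
  refine (hc p).trans_isLittleO (IsLittleO.trans_isTheta ?_ (hc q).symm)
  rcases (Prod.Lex.lt_iff).1 hpq with h | ⟨h, h'⟩
  · change p.1 < q.1 at h
    have h1 := isLittleO_pow_const_mul_const_pow_const_pow_of_norm_lt p.2 (r₁ := p.1) (r₂ := q.1)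
      (by rwa [Real.norm_of_nonneg hp.le])
    refine h1.trans_isBigO (IsBigO.of_bound 1 ?_)
    filter_upwards [eventually_ge_atTop 1] with n hn
    have : (1 : ℝ) ≤ (n : ℝ) ^ q.2 := one_le_pow₀ (by exact_mod_cast hn)
    rw [norm_mul, one_mul]
    refine le_mul_of_one_le_left (norm_nonneg _) ?_
    rwa [Real.norm_of_nonneg (by positivity)]
  · change p.1 = q.1 at h
    change p.2 < q.2 at h'
    rw [h]
    refine IsLittleO.mul_isBigO ?_ (isBigO_refl _ _)
    exact (isLittleO_pow_pow_atTop_of_lt h').comp_tendsto tendsto_natCast_atTop_atTop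

/-- Sums of sequences `n ↦ n.choose k * r ^ n • v` with `0 < r < 1` and with `r` and the
coordinates of `v` in `K`. -/
def IsExpPoly {ι : Type*} (K : IntermediateField ℚ ℝ) (f : ℕ → ι → ℝ) : Prop :=
  ∃ c : (ℝ × ℕ) →₀ (ι → ℝ), (∀ p ∈ c.support, 0 < p.1 ∧ p.1 < 1 ∧ p.1 ∈ K) ∧
    (∀ p j, c p j ∈ K) ∧ ∀ n, f n = c.sum fun p v => ((n.choose p.2 : ℝ) * p.1 ^ n) • v

namespace IsExpPoly

variable {ι : Type*} {K : IntermediateField ℚ ℝ} {f g : ℕ → ι → ℝ}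

theorem zero : IsExpPoly K (0 : ℕ → ι → ℝ) :=
  ⟨0, by simp, by simp, by simp⟩

theorem single {r : ℝ} (h0 : 0 < r) (h1 : r < 1) (hr : r ∈ K) (k : ℕ) {v : ι → ℝ}
    (hv : ∀ j, v j ∈ K) : IsExpPoly K fun n => ((n.choose k : ℝ) * r ^ n) • v := by
  classical
  refine ⟨Finsupp.single (r, k) v, fun p hp => ?_, fun p j => ?_, fun n => ?_⟩
  · obtain rfl := Finset.mem_singleton.1 (Finsupp.support_single_subset hp)
    exact ⟨h0, h1, hr⟩
  · rw [Finsupp.single_apply]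
    split_ifs
    exacts [hv j, K.zero_mem]
  · rw [Finsupp.sum_single_index (by simp)]

theorem add (hf : IsExpPoly K f) (hg : IsExpPoly K g) : IsExpPoly K (f + g) := by
  classical
  obtain ⟨c, hc, hcK, hcf⟩ := hf
  obtain ⟨d, hd, hdK, hdg⟩ := hg
  refine ⟨c + d, fun p hp => ?_, fun p j => K.add_mem (hcK p j) (hdK p j), fun n => ?_⟩
  · exact (Finset.mem_union.1 (Finsupp.support_add hp)).elim (hc p) (hd p)
  · rw [Finsupp.sum_add_index' (by simp) (by simp [smul_add]), ← hcf, ← hdg]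
    rfl

theorem neg (hf : IsExpPoly K f) : IsExpPoly K (-f) := by
  obtain ⟨c, hc, hcK, hcf⟩ := hf
  refine ⟨-c, fun p hp => hc p (by simpa using hp), fun p j => K.neg_mem (hcK p j), fun n => ?_⟩
  rw [Finsupp.sum_neg_index (by simp), Pi.neg_apply, hcf]
  simp [Finsupp.sum]

theorem sub (hf : IsExpPoly K f) (hg : IsExpPoly K g) : IsExpPoly K (f - g) :=
  sub_eq_add_neg f g ▸ hf.add hg.neg

theorem sum {α : Type*} (s : Finset α) {f : α → ℕ → ι → ℝ} (h : ∀ a ∈ s, IsExpPoly K (f a)) :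
    IsExpPoly K (∑ a ∈ s, f a) :=
  Finset.sum_induction _ _ (fun _ _ => add) zero h

theorem mem (hf : IsExpPoly K f) (n : ℕ) (j : ι) : f n j ∈ K := by
  obtain ⟨c, hc, hcK, hcf⟩ := hf
  rw [hcf, Finsupp.sum, Finset.sum_apply]
  refine K.sum_mem fun p hp => K.mul_mem (K.mul_mem (natCast_mem K _) ?_) (hcK p j)
  exact pow_mem (hc p hp).2.2 n

theorem exists_hasSum (hf : IsExpPoly K f) : ∃ x, HasSum f x ∧ ∀ j, x j ∈ K := by
  obtain ⟨c, hc, hcK, hcf⟩ := hf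
  have key (p : ℝ × ℕ) (hp : p ∈ c.support) : HasSum
      (fun n : ℕ => ((n.choose p.2 : ℝ) * p.1 ^ n)) (p.1 ^ p.2 * (1 / (1 - p.1) ^ (p.2 + 1))) := by
    obtain ⟨h0, h1, -⟩ := hc p hp
    have := (hasSum_choose_mul_geometric_of_norm_lt_one p.2 (r := p.1)
      (by rwa [Real.norm_of_nonneg h0.le])).mul_left (p.1 ^ p.2)
    -- The first `p.2` terms vanish, so the index may be shifted to match the known series.
    rw [← hasSum_nat_add_iff' p.2, Finset.sum_eq_zero, sub_zero]
    · refine this.congr_fun fun n => ?_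
      ring
    · intro n hn
      simp [Nat.choose_eq_zero_of_lt (Finset.mem_range.1 hn)]
  refine ⟨c.sum fun p v => (p.1 ^ p.2 * (1 / (1 - p.1) ^ (p.2 + 1))) • v, ?_, fun j => ?_⟩
  · rw [funext hcf]
    exact hasSum_sum fun p hp => (key p hp).smul_const (c p)
  · rw [Finsupp.sum, Finset.sum_apply]
    refine K.sum_mem fun p hp => K.mul_mem (K.mul_mem ?_ ?_) (hcK p j)
    · exact pow_mem (hc p hp).2.2 _
    · exact K.div_mem K.one_mem (pow_mem (K.sub_mem K.one_mem (hc p hp).2.2) _)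

end IsExpPoly

/-! ### Signs of exponential polynomials, uniformly near `τ₀` -/

section sign

variable {ι : Type*} [Fintype ι] {K : IntermediateField ℚ ℝ} {τ₀ : ι → ℝ}

theorem exists_forall_sum_nonneg_of_dominant {q : ℝ × ℕ} {s : Finset (ℝ × ℕ)}
    {c : ℝ × ℕ → ι → ℝ} (hq : 0 < q.1) (hs : ∀ p ∈ s, 0 < p.1)
    (hlt : ∀ p ∈ s, toLex p < toLex q) (hpos : 0 < c q ⬝ᵥ τ₀) :
    ∃ N : ℕ, ∀ᶠ τ in relationNhds K τ₀, ∀ n ≥ N, 0 ≤ ((n.choose q.2 : ℝ) * q.1 ^ n) * (c q ⬝ᵥ τ) +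
      ∑ p ∈ s, ((n.choose p.2 : ℝ) * p.1 ^ n) * (c p ⬝ᵥ τ) := by
  let δ : ℝ := (c q ⬝ᵥ τ₀) / 2
  have hδ : 0 < δ := half_pos hpos
  -- `N` must not depend on `τ`, so it is chosen for the worst case nearby: lower coefficients at
  -- most `|c p ⬝ᵥ τ₀| + 1` in absolute value, leading one at least half its value at `τ₀`.
  have ho : (fun n : ℕ => ∑ p ∈ s, ((n.choose p.2 : ℝ) * p.1 ^ n) * (|c p ⬝ᵥ τ₀| + 1)) =o[atTop]
      fun n : ℕ => (n.choose q.2 : ℝ) * q.1 ^ n :=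
    IsLittleO.fun_sum fun p hp =>
      ((isLittleO_choose_mul_pow (hs p hp) (hlt p hp)).const_mul_left (|c p ⬝ᵥ τ₀| + 1)).congr_left
        fun n => mul_comm _ _
  obtain ⟨N, hN⟩ := eventually_atTop.1 (ho.bound hδ)
  refine ⟨N, ?_⟩
  have hqτ := (tendsto_dotProduct_relationNhds (K := K) (c q)).eventually_const_lt
    (half_lt_self hpos)
  have hpτ : ∀ᶠ τ in relationNhds K τ₀, ∀ p ∈ s, |c p ⬝ᵥ τ| < |c p ⬝ᵥ τ₀| + 1 := by
    rw [Finset.eventually_all]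
    intro p _
    exact (tendsto_dotProduct_relationNhds (K := K) (c p)).abs.eventually_lt_const
      (lt_add_one _)
  filter_upwards [hqτ, hpτ] with τ h1 h2 n hn
  have hb := hN n hn
  have hg : 0 ≤ (n.choose q.2 : ℝ) * q.1 ^ n := by positivity
  rw [Real.norm_of_nonneg hg] at hb
  have hb' := (le_abs_self _).trans hb
  have h3 : -∑ p ∈ s, ((n.choose p.2 : ℝ) * p.1 ^ n) * (|c p ⬝ᵥ τ₀| + 1) ≤
      ∑ p ∈ s, ((n.choose p.2 : ℝ) * p.1 ^ n) * (c p ⬝ᵥ τ) := by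
    rw [← Finset.sum_neg_distrib]
    refine Finset.sum_le_sum fun p hp => ?_
    have h4 := neg_abs_le (c p ⬝ᵥ τ)
    have h5 := h2 p hp
    have h6 : 0 ≤ (n.choose p.2 : ℝ) * p.1 ^ n := by
      have := hs p hp
      positivity
    rw [← mul_neg]
    exact mul_le_mul_of_nonneg_left (by linarith) h6
  have h7 := mul_le_mul_of_nonneg_left h1.le hg
  have h8 : δ = (c q ⬝ᵥ τ₀) / 2 := rfl
  rw [h8] at hb'
  linarith

/-- Induction on the dominant term: if its coefficient vanishes at `τ₀`, that is a relation over
`K`, so the term drops out for all nearby `τ`; otherwise its sign wins. -/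
theorem exists_forall_sum_sign (s : Finset (ℝ × ℕ)) {c : ℝ × ℕ → ι → ℝ}
    (hc : ∀ p j, c p j ∈ K) (hs : ∀ p ∈ s, 0 < p.1) :
    (∃ N : ℕ, ∀ᶠ τ in relationNhds K τ₀, ∀ n ≥ N,
      0 ≤ ∑ p ∈ s, ((n.choose p.2 : ℝ) * p.1 ^ n) * (c p ⬝ᵥ τ)) ∨
    ∃ N : ℕ, ∀ᶠ τ in relationNhds K τ₀, ∀ n ≥ N,
      ∑ p ∈ s, ((n.choose p.2 : ℝ) * p.1 ^ n) * (c p ⬝ᵥ τ) ≤ 0 := by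
  classical
  induction s using Finset.induction_on_max_value (fun p : ℝ × ℕ => toLex p) with
  | empty => exact Or.inl ⟨0, by simp⟩
  | insert q s hqs hle ih =>
    have hs' : ∀ p ∈ s, 0 < p.1 := fun p hp => hs p (Finset.mem_insert_of_mem hp)
    have hq : 0 < q.1 := hs q (Finset.mem_insert_self _ _)
    have hlt : ∀ p ∈ s, toLex p < toLex q := fun p hp =>
      (hle p hp).lt_of_ne fun h => hqs (toLex.injective h ▸ hp)
    simp_rw [Finset.sum_insert hqs]
    rcases lt_trichotomy (c q ⬝ᵥ τ₀) 0 with h | h | h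
    · right
      obtain ⟨N, hN⟩ := exists_forall_sum_nonneg_of_dominant (K := K) (τ₀ := τ₀) (c := -c) hq hs'
        hlt (by simpa [neg_dotProduct] using h)
      refine ⟨N, hN.mono fun τ hτ n hn => ?_⟩
      have := hτ n hn
      simp only [Pi.neg_apply, neg_dotProduct, mul_neg, Finset.sum_neg_distrib] at this
      linarith
    · have hz := eventually_dotProduct_eq_zero (hc q) h
      refine (ih hs').imp ?_ ?_ <;>
      · rintro ⟨N, hN⟩
        refine ⟨N, ?_⟩
        filter_upwards [hN, hz] with τ h1 h2 n hn
        simpa [h2] using h1 n hn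
    · exact Or.inl (exists_forall_sum_nonneg_of_dominant hq hs' hlt h)

theorem IsExpPoly.exists_sign {f : ℕ → ι → ℝ} (hf : IsExpPoly K f) :
    (∃ N : ℕ, ∀ᶠ τ in relationNhds K τ₀, ∀ n ≥ N, 0 ≤ f n ⬝ᵥ τ) ∨
      ∃ N : ℕ, ∀ᶠ τ in relationNhds K τ₀, ∀ n ≥ N, f n ⬝ᵥ τ ≤ 0 := by
  obtain ⟨c, hc, hcK, hcf⟩ := hf
  have := exists_forall_sum_sign (τ₀ := τ₀) c.support hcK fun p hp => (hc p hp).1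
  simpa only [hcf, Finsupp.sum, sum_dotProduct, smul_dotProduct, smul_eq_mul] using this

theorem IsExpPoly.exists_eventual_max {α : Type*} {f : α → ℕ → ι → ℝ} {s : Finset α}
    (hs : s.Nonempty) (hf : ∀ a ∈ s, IsExpPoly K (f a)) :
    ∃ a ∈ s, ∃ N : ℕ, ∀ᶠ τ in relationNhds K τ₀, ∀ n ≥ N, ∀ b ∈ s,
      f b n ⬝ᵥ τ ≤ f a n ⬝ᵥ τ := by
  induction hs using Finset.Nonempty.cons_induction with
  | singleton a => exact ⟨a, by simp, 0, by simp⟩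
  | cons a s ha hs ih =>
    obtain ⟨b, hb, N, hN⟩ := ih fun a ha => hf a (Finset.mem_cons_of_mem ha)
    have hab := (hf a (Finset.mem_cons_self a s)).sub (hf b (Finset.mem_cons_of_mem hb))
    rcases hab.exists_sign (τ₀ := τ₀) with ⟨M, hM⟩ | ⟨M, hM⟩
    · refine ⟨a, Finset.mem_cons_self a s, max M N, ?_⟩
      filter_upwards [hN, hM] with τ h1 h2 n hn b' hb'
      have h3 := h2 n (le_of_max_le_left hn)
      rw [Pi.sub_apply, sub_dotProduct] at h3
      rcases Finset.mem_cons.1 hb' with rfl | hb'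
      · exact le_rfl
      · linarith [h1 n (le_of_max_le_right hn) b' hb']
    · refine ⟨b, Finset.mem_cons_of_mem hb, max M N, ?_⟩
      filter_upwards [hN, hM] with τ h1 h2 n hn b' hb'
      have h3 := h2 n (le_of_max_le_left hn)
      rw [Pi.sub_apply, sub_dotProduct] at h3
      rcases Finset.mem_cons.1 hb' with rfl | hb'
      · linarith
      · exact h1 n (le_of_max_le_right hn) b' hb'

end sign

/-! ### Orbits of the transition matrix -/

/-- An induction principle for orbits of a linear endomorphism with nonzero eigenvalues. -/
theorem Module.End.pow_apply_induction {E V : Type*} [Field E] [IsAlgClosed E] [AddCommGroup V]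
    [Module E V] [FiniteDimensional E V] {T : Module.End E V} {P : (ℕ → V) → Prop} (zero : P 0)
    (add : ∀ f g, P f → P g → P (f + g))
    (gen : ∀ (μ : E) (k : ℕ) (w : V), T.HasEigenvalue μ →
      P fun n => ((n.choose k : E) * μ ^ n) • w)
    (h0 : ¬ T.HasEigenvalue 0) (v : V) : P fun n => (T ^ n) v := by
  have hv : v ∈ ⨆ μ, T.maxGenEigenspace μ := by
    rw [iSup_maxGenEigenspace_eq_top]
    trivial
  induction hv using Submodule.iSup_induction' with
  | zero => simpa using! zero
  | add x y _ _ hx hy =>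
    convert add _ _ hx hy using 1
    ext n
    simp
  | mem μ v hv =>
    by_cases hv0 : v = 0
    · simpa [hv0] using! zero
    obtain ⟨k, hk⟩ := (mem_maxGenEigenspace T μ v).1 hv
    have hμ : T.HasEigenvalue μ := by
      refine hasEigenvalue_of_hasGenEigenvalue (k := k) ?_
      exact (Submodule.ne_bot_iff _).2 ⟨v, mem_genEigenspace_nat.2 hk, hv0⟩
    have hμ0 : μ ≠ 0 := fun h => h0 (h ▸ hμ)
    have hS (s : Finset ℕ) : P (∑ m ∈ s, fun n : ℕ =>
        ((n.choose m : E) * μ ^ n) • ((μ ^ m)⁻¹ • ((T - μ • 1) ^ m) v)) :=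
      Finset.sum_induction _ P add zero fun m _ => gen μ m _ hμ
    convert hS (Finset.range k) using 1
    ext n
    have hc : Commute (T - μ • 1) (μ • (1 : Module.End E V)) :=
      (Commute.one_right _).smul_right μ
    have hexp : (T ^ n) v = ∑ m ∈ Finset.range (n + 1),
        ((n.choose m : E) * μ ^ (n - m)) • ((T - μ • 1) ^ m) v := by
      conv_lhs => rw [← sub_add_cancel T (μ • 1), hc.add_pow, LinearMap.sum_apply]
      refine Finset.sum_congr rfl fun m _ => ?_
      rw [smul_pow, one_pow, mul_smul_comm, mul_one, ← Nat.cast_comm, ← nsmul_eq_mul,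
        LinearMap.smul_apply, LinearMap.smul_apply, mul_smul, Nat.cast_smul_eq_nsmul]
    rw [hexp, Finset.sum_apply]
    have h1 : ∀ m, k ≤ m → ((T - μ • 1) ^ m) v = 0 := fun m hm => by
      rw [← Nat.sub_add_cancel hm, pow_add, Module.End.mul_apply, hk, map_zero]
    have h2 : ∀ m ≤ n, μ ^ n * (μ ^ m)⁻¹ = μ ^ (n - m) := fun m hm => by
      rw [pow_sub₀ _ hμ0 hm]
    -- Both sums extend to the range `max (n + 1) k`: binomials vanish for `m > n`, powers of `T - μ
    -- • 1` kill `v` for `m ≥ k`.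
    rw [Finset.sum_subset (Finset.range_subset_range.2 (le_max_left (n + 1) k)),
      Finset.sum_subset (Finset.range_subset_range.2 (le_max_right (n + 1) k))]
    · refine Finset.sum_congr rfl fun m _ => ?_
      rcases le_or_gt m n with hm | hm
      · rw [smul_smul, mul_assoc, h2 m hm]
      · simp [Nat.choose_eq_zero_of_lt hm]
    · intro m _ hm
      simp [h1 m (by simpa using hm)]
    · intro m _ hm
      simp [Nat.choose_eq_zero_of_lt (show n < m by simpa [Nat.lt_succ_iff] using hm)]

theorem Complex.isAlgebraic_re {z : ℂ} (hz : IsAlgebraic ℚ z) : IsAlgebraic ℚ z.re := by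
  rw [← isAlgebraic_algebraMap_iff (A := ℂ) (algebraMap ℝ ℂ).injective]
  have h : algebraMap ℝ ℂ z.re = (z + (starRingEnd ℂ) z) * algebraMap ℚ ℂ (1 / 2) := by
    rw [Complex.add_conj]
    push_cast
    simp
    ring
  rw [h]
  exact (hz.add (hz.algHom (Complex.conjAe.restrictScalars ℚ).toAlgHom)).mul
    (isAlgebraic_algebraMap _)

namespace LTISystem

variable {d : ℕ} {L : LTISystem d}

theorem isExpPoly_pow_mulVec (hρ : spectralRadius ℂ L.complexMatrix < 1)
    (hpos : ∀ z ∈ spectrum ℂ L.complexMatrix, z.im = 0 ∧ 0 < z.re) (q : Fin d → ℚ) :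
    IsExpPoly (algebraicClosure ℚ ℝ)
      fun n => (L.realMatrix ^ n) *ᵥ fun j => (q j : ℝ) := by
  -- Decomposing over the algebraic numbers rather than `ℂ` makes the generalized eigenvectors
  -- algebraic; real parts then bring the orbit back to `ℝ`.
  let E := algebraicClosure ℚ ℂ
  have : IsAlgClosed E := (algebraicClosure.isAlgClosure ℚ ℂ).isAlgClosed
  let B : Matrix (Fin d) (Fin d) E := L.A.map (algebraMap ℚ E)
  have hspec (μ : E) (hμ : Module.End.HasEigenvalue (Matrix.toLin' B) μ) :
      (μ : ℂ) ∈ spectrum ℂ L.complexMatrix := by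
    rw [Module.End.hasEigenvalue_iff_mem_spectrum, Matrix.spectrum_toLin',
      Matrix.mem_spectrum_iff_isRoot_charpoly] at hμ
    rw [Matrix.mem_spectrum_iff_isRoot_charpoly]
    have := hμ.map (f := algebraMap E ℂ)
    rw [← Matrix.charpoly_map] at this
    exact this
  have key := Module.End.pow_apply_induction (T := Matrix.toLin' B)
    (P := fun f => IsExpPoly (algebraicClosure ℚ ℝ) fun n j => (f n j : ℂ).re)
    IsExpPoly.zero (fun f g hf hg => hf.add hg) ?_ ?_ (fun j => algebraMap ℚ E (q j))
  · convert key using 2 with n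
    beta_reduce
    rw [← Matrix.toLin'_pow, Matrix.toLin'_apply]
    have h1 : (B ^ n) *ᵥ (fun j => algebraMap ℚ E (q j)) =
        fun j => algebraMap ℚ E ((L.A ^ n *ᵥ q) j) := by
      funext j
      rw [RingHom.map_mulVec, Matrix.map_pow]
      rfl
    have h2 : (L.realMatrix ^ n) *ᵥ (fun j => (q j : ℝ)) =
        fun j => algebraMap ℚ ℝ ((L.A ^ n *ᵥ q) j) := by
      funext j
      rw [RingHom.map_mulVec, Matrix.map_pow]
      rfl
    rw [h1, h2]
    funext j
    simp
  · intro μ k w hμ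
    obtain ⟨him, hre⟩ := hpos _ (hspec μ hμ)
    have hμre : (μ : ℂ) = ((μ : ℂ).re : ℂ) := Complex.ext rfl (by simpa using him)
    have hlt : (μ : ℂ).re < 1 := by
      have h1 : (‖(μ : ℂ)‖₊ : ENNReal) < 1 :=
        (le_iSup₂ (f := fun k (_ : k ∈ spectrum ℂ L.complexMatrix) => (‖k‖₊ : ENNReal))
          (μ : ℂ) (hspec μ hμ)).trans_lt hρ
      have h2 : ‖(μ : ℂ)‖ < 1 := by exact_mod_cast h1
      exact (Complex.re_le_norm _).trans_lt h2
    have halg (z : E) : (z : ℂ).re ∈ algebraicClosure ℚ ℝ :=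
      mem_algebraicClosure_iff.2 (Complex.isAlgebraic_re (mem_algebraicClosure_iff.1 z.2))
    convert IsExpPoly.single hre hlt (halg μ) k (v := fun j => (w j : ℂ).re)
      (fun j => halg (w j)) using 3 with n j
    have h3 : ((((n.choose k : E) * μ ^ n) • w) j : ℂ) =
        (((n.choose k : ℝ) * (μ : ℂ).re ^ n : ℝ) : ℂ) * (w j : ℂ) := by
      push_cast
      rw [← hμre]
      simp
    rw [h3, Complex.re_ofReal_mul]
    rfl
  · intro h
    simpa using (hpos _ (hspec 0 h)).2

end LTISystem

/-! ### Algebraic maximisers and separators -/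

theorem HasSum.dotProduct_const {α ι : Type*} [Fintype ι] {f : α → ι → ℝ} {x : ι → ℝ}
    (hf : HasSum f x) (τ : ι → ℝ) : HasSum (fun a => f a ⬝ᵥ τ) (x ⬝ᵥ τ) := by
  simp only [dotProduct]
  exact hasSum_sum fun j _ => (Pi.hasSum.1 hf j).mul_right (τ j)

theorem dotProduct_le_of_mem_convexHull {ι : Type*} [Fintype ι] {s : Set (ι → ℝ)} {τ x : ι → ℝ}
    {r : ℝ} (h : ∀ y ∈ s, y ⬝ᵥ τ ≤ r) (hx : x ∈ convexHull ℝ s) : x ⬝ᵥ τ ≤ r :=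
  convexHull_min h (convex_halfSpace_le
    ⟨fun x y => add_dotProduct x y τ, fun c x => smul_dotProduct c x τ⟩ r) hx

theorem le_dotProduct_of_mem_convexHull {ι : Type*} [Fintype ι] {s : Set (ι → ℝ)} {τ x : ι → ℝ}
    {r : ℝ} (h : ∀ y ∈ s, r ≤ y ⬝ᵥ τ) (hx : x ∈ convexHull ℝ s) : r ≤ x ⬝ᵥ τ :=
  convexHull_min h (convex_halfSpace_ge
    ⟨fun x y => add_dotProduct x y τ, fun c x => smul_dotProduct c x τ⟩ r) hx

namespace LTISystem

variable {d : ℕ} {L : LTISystem d}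

/-- A point of `A^∞(U)` with algebraic coordinates maximises over `A^∞(U)` every functional in an
algebraic neighbourhood of a given functional. -/
theorem exists_algebraic_forall_dotProduct_le {s : Finset (Fin d → ℝ)} (hs : s.Nonempty)
    (hU : L.U = convexHull ℝ (s : Set (Fin d → ℝ)))
    (hexp : ∀ v ∈ s, IsExpPoly (algebraicClosure ℚ ℝ) fun n => (L.realMatrix ^ n) *ᵥ v)
    (τ₀ : Fin d → ℝ) :
    ∃ x ∈ L.limitReachableSet, (∀ j, x j ∈ algebraicClosure ℚ ℝ) ∧
      ∀ᶠ τ in relationNhds (algebraicClosure ℚ ℝ) τ₀,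
        ∀ u ∈ L.limitReachableSet, u ⬝ᵥ τ ≤ x ⬝ᵥ τ := by
  obtain ⟨v, hv, N, hN⟩ := IsExpPoly.exists_eventual_max (τ₀ := τ₀) hs hexp
  choose σ hσs hσ using fun n : ℕ =>
    s.exists_max_image (fun w => ((L.realMatrix ^ n) *ᵥ w) ⬝ᵥ τ₀) hs
  obtain ⟨y, hy, hyK⟩ := (hexp v hv).exists_hasSum
  -- Optimal controls: maximisers at `τ₀` before time `N`, then the eventually optimal vertex. The
  -- sum differs from the series of `v` by finitely many algebraic terms.
  let c (n : ℕ) : Fin d → ℝ := if n < N then σ n else v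
  have hcs (n) : c n ∈ s := by
    simp only [c]
    split_ifs
    exacts [hσs n, hv]
  let x := y + ∑ n ∈ Finset.range N, ((L.realMatrix ^ n) *ᵥ c n - (L.realMatrix ^ n) *ᵥ v)
  have hx : HasSum (fun n => (L.realMatrix ^ n) *ᵥ c n) x := by
    have h := hy.add (hasSum_sum_of_ne_finset_zero (s := Finset.range N)
      (f := fun n => (L.realMatrix ^ n) *ᵥ c n - (L.realMatrix ^ n) *ᵥ v) fun n hn => by
        simp [c, show ¬ n < N by simpa using hn])
    simpa [x] using h
  refine ⟨x, ⟨c, fun n => hU ▸ subset_convexHull ℝ _ (hcs n), hx⟩, fun j => ?_, ?_⟩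
  · simp only [x, Pi.add_apply, Finset.sum_apply, Pi.sub_apply]
    exact add_mem (hyK j) (sum_mem fun n _ =>
      sub_mem ((hexp _ (hcs n)).mem n j) ((hexp v hv).mem n j))
  · have hfin : ∀ᶠ τ in relationNhds (algebraicClosure ℚ ℝ) τ₀, ∀ n ∈ Finset.range N, ∀ w ∈ s,
        ((L.realMatrix ^ n) *ᵥ w) ⬝ᵥ τ ≤ ((L.realMatrix ^ n) *ᵥ σ n) ⬝ᵥ τ := by
      simp only [Finset.eventually_all]
      exact fun n _ w hw => eventually_dotProduct_le ((hexp w hw).mem n)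
        ((hexp _ (hσs n)).mem n) (hσ n w hw)
    filter_upwards [hN, hfin] with τ h1 h2 u hu
    obtain ⟨a, ha, hau⟩ := hu
    refine hasSum_le (fun n => ?_) (hau.dotProduct_const τ) (hx.dotProduct_const τ)
    have hn : ∀ w ∈ s, ((L.realMatrix ^ n) *ᵥ w) ⬝ᵥ τ ≤ ((L.realMatrix ^ n) *ᵥ c n) ⬝ᵥ τ := by
      intro w hw
      by_cases h : n < N
      · simpa [c, h] using h2 n (Finset.mem_range.2 h) w hw
      · simpa [c, h] using h1 n (not_lt.1 h) w hw
    have hadj (w : Fin d → ℝ) :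
        ((L.realMatrix ^ n) *ᵥ w) ⬝ᵥ τ = w ⬝ᵥ (τ ᵥ* (L.realMatrix ^ n)) := by
      rw [dotProduct_comm, Matrix.dotProduct_mulVec, dotProduct_comm]
    rw [hadj]
    refine dotProduct_le_of_mem_convexHull (fun w hw => ?_) (hU ▸ ha n)
    rw [← hadj]
    exact hn w hw

end LTISystem

theorem mainTheorem2 {d : ℕ} (L : LTISystem d) (hL : L.IsSimple)
    (hpos : ∀ z ∈ spectrum ℂ L.complexMatrix, z.im = 0 ∧ 0 < z.re)
    (hfull : affineSpan ℝ L.reachableSet = ⊤)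
    (Q : Set (Fin d → ℝ)) (hQ : IsRationalPolytope Q)
    (hsep : ∃ τ : Fin d → ℝ, L.IsSeparator Q τ) :
    ∃ τ : Fin d → ℝ, L.IsSeparator Q τ ∧ ∀ i, IsAlgebraic ℚ (τ i) := by
  obtain ⟨τ₀, hτ₀, hsep₀⟩ := hsep
  obtain ⟨s, hsQ, hU⟩ := hL.polytope
  obtain ⟨t, htQ, rfl⟩ := hQ
  have hs : s.Nonempty := by
    obtain ⟨B, hB, hBU⟩ := hL.zero_mem_relInterior
    have h0 : (0 : Fin d → ℝ) ∈ L.U := hBU ⟨mem_of_mem_nhds hB, zero_mem _⟩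
    rw [hU] at h0
    exact_mod_cast convexHull_nonempty_iff.1 ⟨0, h0⟩
  have hexp : ∀ v ∈ s, IsExpPoly (algebraicClosure ℚ ℝ) fun n => (L.realMatrix ^ n) *ᵥ v := by
    intro v hv
    choose q hq using hsQ v hv
    rw [funext hq]
    exact LTISystem.isExpPoly_pow_mulVec hL.spectralRadius_lt_one hpos q
  obtain ⟨x, hxL, hxK, hx⟩ := LTISystem.exists_algebraic_forall_dotProduct_le hs hU hexp τ₀
  have hxt : ∀ᶠ τ in relationNhds (algebraicClosure ℚ ℝ) τ₀, ∀ v ∈ t, x ⬝ᵥ τ ≤ v ⬝ᵥ τ := by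
    rw [Finset.eventually_all]
    refine fun v hv => eventually_dotProduct_le hxK (fun j => ?_)
      (hsep₀ x hxL v (subset_convexHull ℝ _ hv))
    obtain ⟨q, hq⟩ := htQ v hv j
    exact hq ▸ SubfieldClass.ratCast_mem _ q
  have hne : ∀ᶠ τ in relationNhds (algebraicClosure ℚ ℝ) τ₀, τ ≠ 0 :=
    relationNhds_le_nhds (isOpen_ne.mem_nhds hτ₀)
  obtain ⟨τ, hτK, hτ⟩ := exists_mem_of_eventually_relationNhds (hx.and (hxt.and hne))
  obtain ⟨h1, h2, h3⟩ := hτ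
  exact ⟨τ, ⟨h3, fun u hu v hv => le_dotProduct_of_mem_convexHull
    (fun w hw => (h1 u hu).trans (h2 w hw)) hv⟩, fun i => mem_algebraicClosure_iff.1 (hτK i)⟩
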